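/- Let $M$ be a compact, connected, smooth manifold (Hausdorff, without boundary) of dimension $m$, equipped with a Riemannian metric $g$ with Riemannian distance $d_g$. Let $\mathbf A=\mathbb R\oplus\mathcal A$ be a Weil algebra, that is, a finite-dimensional commutative associative unital $\mathbb R$-algebra with a maximal ideal $\mathcal A$ some power of which vanishes, and let $k\ge 0$ be an integer with $\mathcal A^{k+1}=0$. Let $M^{\mathbf A}$ be the set of infinitely near points of $M$ of kind $\mathbf A$: the $\mathbb R$-algebra morphisms $\zeta:C^\infty(M)\to\mathbf A$ for which there is a point $x=\pi_{\mathbf A}(\zeta)\in M$ such that $L_\zeta(f):=\zeta(f)-f(x)\,1_{\mathbf A}\in\mathcal A$ for all $f\in C^\infty(M)$. Fix a basis $\alpha_1=1_{\mathbf A},\alpha_2,\dots,\alpha_l$ of $\mathbf A$ with $\alpha_2,\dots,\alpha_l\in\mathcal A$, a vector space norm $\|\cdot\|_{\mathbf A}$ on $\mathbf A$, and positive real weights $w=(w_1,\dots,w_l)$, and for $a=\sum_{i=1}^l a_i\alpha_i$ put $$\|a\|_w=|a_1|+\Big\|\sum_{i=2}^l a_iw_i\alpha_i\Big\|_{\mathbf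 A}.$$ Fix finitely many smooth charts $(U_j,\phi_j)$ of $M$ and compact sets $K_j\subseteq U_j$ with $\bigcup_jK_j=M$, and let $\mathfrak B^1_k(M)$ be the set of all $f\in C^\infty(M)$ such that, for every $j$, all partial derivatives of $f$ of order at most $k$ in the coordinates $\phi_j$ are bounded by $1$ in absolute value on $K_j$. For $\vartheta,\varepsilon\in M^{\mathbf A}$ put $$\mathfrak d_w(\vartheta,\varepsilon)=d_g(\pi_{\mathbf A}(\vartheta),\pi_{\mathbf A}(\varepsilon))+\sup_{f\in\mathfrak B^1_k(M)}\|L_\vartheta(f)-L_\varepsilon(f)\|_w .$$ Then $\mathfrak d_w$ is a (finite-valued) metric on $M^{\mathbf A}$, and the metric space $(M^{\mathbf A},\mathfrak d_w)$ is complete. -/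

import Mathlib

open scoped Manifold ContDiff ENNReal Bundle

/-- `A` is a Weil algebra with nilpotent maximal ideal `𝔫`: a finite-dimensional commutative
associative unital real algebra, equal to the direct sum `ℝ · 1 ⊕ 𝔫`, where `𝔫` is a maximal ideal
some power of which vanishes. -/
structure IsWeilAlgebra (A : Type*) [CommRing A] [Algebra ℝ A] (𝔫 : Ideal A) : Prop where
  finiteDimensional : FiniteDimensional ℝ A
  isMaximal : 𝔫.IsMaximal
  isCompl : IsCompl (LinearMap.range (Algebra.linearMap ℝ A)) (𝔫.restrictScalars ℝ)
  nilpotent : ∃ k : ℕ, 1 ≤ k ∧ 𝔫 ^ (k + 1) = ⊥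

/-- The Weil bundle `M^A`: the set of all infinitely near points of `M` of kind `A = ℝ ⊕ 𝔫`.
Such a point is an algebra morphism `ζ : C^∞(M) → A` lying over a point `x` of `M`, meaning that the
real part of `ζ f` is `f x`, i.e. that `ζ f - f x · 1` belongs to `𝔫`. -/
structure WeilBundle (m : ℕ) (M : Type*) [TopologicalSpace M]
    [ChartedSpace (EuclideanSpace ℝ (Fin m)) M]
    (A : Type*) [CommRing A] [Algebra ℝ A] (𝔫 : Ideal A) where
  /-- the base point `π_A ζ` -/
  base : M
  /-- the morphism itself -/
  toAlgHom : C^∞⟮𝓡 m, M; 𝓘(ℝ, ℝ), ℝ⟯ →ₐ[ℝ] A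
  sub_mem : ∀ f : C^∞⟮𝓡 m, M; 𝓘(ℝ, ℝ), ℝ⟯, toAlgHom f - algebraMap ℝ A (f base) ∈ 𝔫

/-- The infinitesimal part `L_ζ f = ζ f - f (π_A ζ)` of an infinitely near point. -/
noncomputable def WeilBundle.infinitesimalPart {m : ℕ} {M : Type*} [TopologicalSpace M]
    [ChartedSpace (EuclideanSpace ℝ (Fin m)) M]
    {A : Type*} [CommRing A] [Algebra ℝ A] {𝔫 : Ideal A}
    (ζ : WeilBundle m M A 𝔫) (f : C^∞⟮𝓡 m, M; 𝓘(ℝ, ℝ), ℝ⟯) : A :=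
  ζ.toAlgHom f - algebraMap ℝ A (f ζ.base)

/-- The choice needed to speak of the sizes of the partial derivatives of a function on a compact
manifold: finitely many smooth charts, with a compact subset of each chart domain such that these
compact sets cover the manifold. -/
structure CompactAtlas (m : ℕ) (M : Type*) [TopologicalSpace M]
    [ChartedSpace (EuclideanSpace ℝ (Fin m)) M] where
  /-- the number of charts -/
  card : ℕ
  /-- the charts -/
  chart : Fin card → OpenPartialHomeomorph M (EuclideanSpace ℝ (Fin m))
  /-- the compact sets -/
  piece : Fin card → Set M
  chart_mem : ∀ j, chart j ∈ IsManifold.maximalAtlas (𝓡 m) ∞ M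
  isCompact_piece : ∀ j, IsCompact (piece j)
  piece_subset : ∀ j, piece j ⊆ (chart j).source
  iUnion_piece : ⋃ j, piece j = Set.univ

/-- The iterated partial derivative `∂^r f / ∂x^{i_1} ⋯ ∂x^{i_r}` at `x`, in the chart `φ`. -/
noncomputable def chartPartialDeriv {m : ℕ} {M : Type*} [TopologicalSpace M]
    (φ : OpenPartialHomeomorph M (EuclideanSpace ℝ (Fin m))) {r : ℕ} (i : Fin r → Fin m)
    (f : M → ℝ) (x : M) : ℝ :=
  iteratedFDeriv ℝ r (f ∘ φ.symm) (φ x) (fun s => EuclideanSpace.single (i s) (1 : ℝ))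

/-- The `C^k` unit ball: the smooth functions all of whose partial derivatives of order at most `k`,
in the charts of `𝒰`, are bounded by `1` everywhere on `M`. -/
def ckUnitBall {m : ℕ} {M : Type*} [TopologicalSpace M]
    [ChartedSpace (EuclideanSpace ℝ (Fin m)) M] (𝒰 : CompactAtlas m M) (k : ℕ) :
    Set (C^∞⟮𝓡 m, M; 𝓘(ℝ, ℝ), ℝ⟯) :=
  {f | ∀ j, ∀ x ∈ 𝒰.piece j, ∀ r ≤ k, ∀ i : Fin r → Fin m,
    |chartPartialDeriv (𝒰.chart j) i f x| ≤ 1}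

/-- The weighted norm `‖a‖_w = |a_1| + N (∑_{i ≥ 2} a_i w_i α_i)` where `a = ∑ a_i α_i`
(indices start at `0` in the code) and `N` is a given norm on `A`. -/
noncomputable def weightedNorm {A : Type*} [CommRing A] [Algebra ℝ A] {n : ℕ}
    (N : Seminorm ℝ A) (α : Module.Basis (Fin (n + 1)) ℝ A) (w : Fin (n + 1) → ℝ) (a : A) : ℝ :=
  |α.repr a 0| + N (∑ i : Fin n, (α.repr a i.succ * w i.succ) • α i.succ)

/-- The distance `d_w` on `M^A`: the Riemannian distance between the base points, plus the supremum
over the `C^k` unit ball of `‖L_ϑ f - L_ε f‖_w`. It is formed in `[0, ∞]`, so that neither the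
infimum of lengths nor the supremum takes a junk value. -/
noncomputable def weilEDist {m : ℕ} {M : Type*} [TopologicalSpace M]
    [ChartedSpace (EuclideanSpace ℝ (Fin m)) M]
    [Bundle.RiemannianBundle (fun x : M => TangentSpace (𝓡 m) x)]
    {A : Type*} [CommRing A] [Algebra ℝ A] {𝔫 : Ideal A} {n : ℕ}
    (𝒰 : CompactAtlas m M) (k : ℕ) (N : Seminorm ℝ A) (α : Module.Basis (Fin (n + 1)) ℝ A)
    (w : Fin (n + 1) → ℝ) (ϑ ε : WeilBundle m M A 𝔫) : ℝ≥0∞ :=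
  Manifold.riemannianEDist (𝓡 m) ϑ.base ε.base +
    ⨆ f ∈ ckUnitBall 𝒰 k,
      ENNReal.ofReal (weightedNorm N α w (ϑ.infinitesimalPart f - ε.infinitesimalPart f))

/-!
The distance is the sum of the Riemannian distance of the base points and of a supremum over the
`C^k` unit ball, called `fiberEDist` below. Symmetry and the triangle inequality hold for each
summand, and the Riemannian distance is finite because its finite-distance classes are clopen in
the connected manifold `M`.

The one deeper point is that the supremum is finite. An infinitely near point `ζ` over `x` only
sees germs at `x` (`WeilBundle.toAlgHom_congr`). A smooth function whose `k`-jet at `x` vanishes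
is, in a chart, a sum of products of `k + 1` functions vanishing at `x` with smooth coefficients;
this is Taylor's theorem (`vanishesToOrder_of_iteratedFDeriv_eq_zero`), obtained by iterating
Hadamard's lemma. As `ζ` maps functions vanishing at `x` into the maximal ideal `𝔫`, and `𝔫 ^ (k +
1) = 0`, it kills such a function. Hence the infinitesimal part of `ζ` factors linearly through the
finitely many partial derivatives of order at most `k` at `x`, and these are bounded by `1` on the
unit ball (`WeilBundle.exists_bound_infinitesimalPart`).

By compactness every smooth function has a positive multiple in the unit ball, so that `fiberEDist`
controls the value of every function. This gives definiteness. For completeness, the base points of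
a Cauchy sequence converge because `M` is compact, and the morphisms converge pointwise because the
algebra is finite-dimensional. The pointwise limit is a morphism over the limit point, and the
Cauchy bounds, being uniform over the unit ball, pass to it.
-/

section

open Manifold MeasureTheory Filter Topology

/-! ### Taylor's theorem with smooth remainder -/

theorem hasFDerivAt_parametric_intervalIntegral {E G : Type*} [NormedAddCommGroup E]
    [NormedSpace ℝ E] [ProperSpace E] [NormedAddCommGroup G] [NormedSpace ℝ G]
    {u : E × ℝ → G} (hu : ContDiff ℝ 1 u) (a b : ℝ) (x : E) :
    HasFDerivAt (fun y => ∫ t in a..b, u (y, t))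
      (∫ t in a..b, (fderiv ℝ u (x, t)).comp (ContinuousLinearMap.inl ℝ E ℝ)) x := by
  have hcont : Continuous fun q : E × ℝ =>
      (fderiv ℝ u q).comp (ContinuousLinearMap.inl ℝ E ℝ) :=
    (hu.continuous_fderiv one_ne_zero).clm_comp continuous_const
  obtain ⟨C, hC⟩ := ((isCompact_closedBall x 1).prod
    (isCompact_uIcc (a := a) (b := b))).exists_bound_of_continuousOn hcont.continuousOn
  refine intervalIntegral.hasFDerivAt_integral_of_dominated_of_fderiv_le
    (F := fun y t => u (y, t))
    (F' := fun y t => (fderiv ℝ u (y, t)).comp (ContinuousLinearMap.inl ℝ E ℝ))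
    (bound := fun _ => C) (Metric.closedBall_mem_nhds x one_pos) ?_ ?_ ?_ ?_ ?_ ?_
  · exact .of_forall fun y =>
      (hu.continuous.comp (Continuous.prodMk_right y)).aestronglyMeasurable
  · exact (hu.continuous.comp (Continuous.prodMk_right x)).intervalIntegrable _ _
  · exact (hcont.comp (Continuous.prodMk_right x)).aestronglyMeasurable
  · exact .of_forall fun t ht y hy => hC (y, t) ⟨hy, Set.uIoc_subset_uIcc ht⟩
  · exact intervalIntegrable_const
  · refine .of_forall fun t _ y _ => ?_
    exact ((hu.differentiable one_ne_zero).differentiableAt.hasFDerivAt (x := (y, t))).comp y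
      (hasFDerivAt_prodMk_left y t)

universe u in
/-- Both spaces live in one universe because the induction replaces `G` by `E →L[ℝ] G`. -/
theorem contDiff_parametric_intervalIntegral {E : Type u} [NormedAddCommGroup E]
    [NormedSpace ℝ E] [ProperSpace E] (n : ℕ) {G : Type u} [NormedAddCommGroup G]
    [NormedSpace ℝ G] {u : E × ℝ → G} (hu : ContDiff ℝ ∞ u) (a b : ℝ) :
    ContDiff ℝ n (fun y => ∫ t in a..b, u (y, t)) := by
  induction n generalizing G with
  | zero =>
    exact contDiff_zero.2 (continuous_iff_continuousAt.2 fun x =>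
      (hasFDerivAt_parametric_intervalIntegral (hu.of_le (by simp)) a b x).continuousAt)
  | succ n ih =>
    have h1 : ContDiff ℝ 1 u := hu.of_le (by simp)
    refine contDiff_succ_iff_fderiv.2 ⟨fun x =>
      (hasFDerivAt_parametric_intervalIntegral h1 a b x).differentiableAt,
      fun h => absurd h (WithTop.natCast_ne_top n), ?_⟩
    have : fderiv ℝ (fun y => ∫ t in a..b, u (y, t)) = fun y =>
        ∫ t in a..b, (fderiv ℝ u (y, t)).comp (ContinuousLinearMap.inl ℝ E ℝ) :=
      funext fun x => (hasFDerivAt_parametric_intervalIntegral h1 a b x).fderiv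
    rw [this]
    exact ih (u := fun q => (fderiv ℝ u q).comp (ContinuousLinearMap.inl ℝ E ℝ))
      ((hu.fderiv_right (m := ∞) (by simp)).clm_comp contDiff_const)

/-- `VanishesToOrder p j F` says that the smooth function `F` lies in the `j`-th power of the ideal
of smooth functions vanishing at `p`. It is unfolded one coordinate factor at a time:
`F = ∑ i, (y i - p i) * g i y` with each `g i` vanishing to order `j - 1`. -/
def VanishesToOrder {m : ℕ} (p : EuclideanSpace ℝ (Fin m)) :
    ℕ → (EuclideanSpace ℝ (Fin m) → ℝ) → Prop
  | 0, F => ContDiff ℝ ∞ F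
  | j + 1, F => ∃ g : Fin m → EuclideanSpace ℝ (Fin m) → ℝ,
      (∀ i, VanishesToOrder p j (g i)) ∧ F = fun y => ∑ i, (y i - p i) * g i y

theorem VanishesToOrder.contDiff {m : ℕ} {p : EuclideanSpace ℝ (Fin m)} {j : ℕ}
    {F : EuclideanSpace ℝ (Fin m) → ℝ} (hF : VanishesToOrder p j F) : ContDiff ℝ ∞ F := by
  induction j generalizing F with
  | zero => exact hF
  | succ j ih =>
    obtain ⟨g, hg, rfl⟩ := hF
    exact ContDiff.sum fun i _ => (by fun_prop : ContDiff ℝ ∞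
      fun y : EuclideanSpace ℝ (Fin m) => y i - p i).mul (ih (hg i))

/-- Averaging along the rays from `p` keeps the order of vanishing. The weight `t ^ c` absorbs the
powers of `t` that the coordinate factors give off. -/
theorem VanishesToOrder.integral_segment {m : ℕ} {p : EuclideanSpace ℝ (Fin m)} {j : ℕ}
    {F : EuclideanSpace ℝ (Fin m) → ℝ} (hF : VanishesToOrder p j F) (c : ℕ) :
    VanishesToOrder p j (fun y => ∫ t in (0 : ℝ)..1, t ^ c * F (p + t • (y - p))) := by
  induction j generalizing F c with
  | zero =>
    have hF' : ContDiff ℝ ∞ F := hF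
    exact contDiff_infty.2 fun n => contDiff_parametric_intervalIntegral n
      (u := fun q : EuclideanSpace ℝ (Fin m) × ℝ => q.2 ^ c * F (p + q.2 • (q.1 - p)))
      (by fun_prop) 0 1
  | succ j ih =>
    obtain ⟨g, hg, rfl⟩ := hF
    refine ⟨_, fun i => ih (hg i) (c + 1), funext fun y => ?_⟩
    have hint : ∀ i, IntervalIntegrable
        (fun t : ℝ => (y i - p i) * (t ^ (c + 1) * g i (p + t • (y - p)))) volume 0 1 := by
      intro i
      have := (hg i).contDiff.continuous
      exact Continuous.intervalIntegrable (by fun_prop) _ _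
    simp_rw [← intervalIntegral.integral_const_mul]
    rw [← intervalIntegral.integral_finsetSum fun i _ => hint i]
    refine intervalIntegral.integral_congr fun t _ => ?_
    simp only [Finset.mul_sum]
    refine Finset.sum_congr rfl fun i _ => ?_
    simp only [PiLp.add_apply, PiLp.smul_apply, PiLp.sub_apply, smul_eq_mul]
    ring

/-- Hadamard's lemma. -/
theorem eq_sum_integral_fderiv {m : ℕ} {p : EuclideanSpace ℝ (Fin m)}
    {F : EuclideanSpace ℝ (Fin m) → ℝ} (hF : ContDiff ℝ ∞ F) (hp : F p = 0)
    (y : EuclideanSpace ℝ (Fin m)) :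
    F y = ∑ i, (y i - p i) * ∫ t in (0 : ℝ)..1,
      fderiv ℝ F (p + t • (y - p)) (EuclideanSpace.single i 1) := by
  have hd : ∀ t : ℝ, HasDerivAt (fun s : ℝ => F (p + s • (y - p)))
      (fderiv ℝ F (p + t • (y - p)) (y - p)) t := fun t => by
    have h1 : HasDerivAt (fun s : ℝ => p + s • (y - p)) (y - p) t := by
      simpa using ((hasDerivAt_id t).smul_const (y - p)).const_add p
    exact ((hF.differentiable (by simp)).differentiableAt.hasFDerivAt).comp_hasDerivAt t h1
  have hc : Continuous (fderiv ℝ F) := hF.continuous_fderiv (by simp)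
  have h := intervalIntegral.integral_eq_sub_of_hasDerivAt (a := 0) (b := 1)
    (fun t _ => hd t) (Continuous.intervalIntegrable (by fun_prop) _ _)
  simp only [one_smul, add_sub_cancel, zero_smul, add_zero, hp, sub_zero] at h
  rw [← h]
  simp_rw [← intervalIntegral.integral_const_mul]
  rw [← intervalIntegral.integral_finsetSum
    fun i _ => Continuous.intervalIntegrable (by fun_prop) _ _]
  refine intervalIntegral.integral_congr fun t _ => ?_
  have hy : y - p = ∑ i, (y i - p i) • EuclideanSpace.single i (1 : ℝ) := by
    ext i
    simp [Finset.sum_apply, Pi.single_apply]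
  conv_lhs => rw [show fderiv ℝ F (p + t • (y - p)) (y - p) =
    fderiv ℝ F (p + t • (y - p)) (∑ i, (y i - p i) • EuclideanSpace.single i (1 : ℝ)) from
      congrArg _ hy]
  simp

/-- A function vanishing at `p` whose partial derivatives vanish to order `j` vanishes to order
`j + 1`, by Hadamard's lemma. -/
theorem vanishesToOrder_succ_of_fderiv {m : ℕ} {p : EuclideanSpace ℝ (Fin m)} {j : ℕ}
    {F : EuclideanSpace ℝ (Fin m) → ℝ} (hF : ContDiff ℝ ∞ F) (hp : F p = 0)
    (h : ∀ i, VanishesToOrder p j (fun y => fderiv ℝ F y (EuclideanSpace.single i 1))) :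
    VanishesToOrder p (j + 1) F :=
  ⟨_, fun i => by simpa using (h i).integral_segment 0, funext (eq_sum_integral_fderiv hF hp)⟩

theorem iteratedFDeriv_fderiv_apply_eq_zero {m : ℕ} {p : EuclideanSpace ℝ (Fin m)} {r : ℕ}
    {F : EuclideanSpace ℝ (Fin m) → ℝ} (hF : ContDiff ℝ ∞ F)
    (h : iteratedFDeriv ℝ (r + 1) F p = 0) (e : EuclideanSpace ℝ (Fin m)) :
    iteratedFDeriv ℝ r (fun y => fderiv ℝ F y e) p = 0 := by
  have h1 : iteratedFDeriv ℝ r (fun y => fderiv ℝ F y e) p = _ :=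
    (ContinuousLinearMap.apply ℝ ℝ e).iteratedFDeriv_comp_left (x := p) (i := r)
      (hF.fderiv_right (m := ∞) (by simp)).contDiffAt (by exact_mod_cast le_top)
  rw [h1]
  ext v
  have h2 := iteratedFDeriv_succ_apply_right (𝕜 := ℝ) (f := F) (x := p) (Fin.snoc v e)
  rw [h] at h2
  simpa using h2.symm

/-- Taylor's theorem: a smooth function whose derivatives of order at most `j` vanish at `p` lies in
the power `j + 1` of the ideal of the functions vanishing at `p`. -/
theorem vanishesToOrder_of_iteratedFDeriv_eq_zero {m : ℕ} {p : EuclideanSpace ℝ (Fin m)} {j : ℕ}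
    {F : EuclideanSpace ℝ (Fin m) → ℝ} (hF : ContDiff ℝ ∞ F)
    (h : ∀ r ≤ j, iteratedFDeriv ℝ r F p = 0) : VanishesToOrder p (j + 1) F := by
  have hp : ∀ {F : EuclideanSpace ℝ (Fin m) → ℝ}, iteratedFDeriv ℝ 0 F p = 0 → F p = 0 :=
    fun h0 => by simpa using congrArg (fun L => L 0) h0
  have hs : ∀ {F : EuclideanSpace ℝ (Fin m) → ℝ}, ContDiff ℝ ∞ F → ∀ e,
      ContDiff ℝ ∞ fun y => fderiv ℝ F y e := fun hF e =>
    (hF.fderiv_right (m := ∞) (by simp)).clm_apply contDiff_const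
  induction j generalizing F with
  | zero => exact vanishesToOrder_succ_of_fderiv hF (hp (h 0 le_rfl)) fun i => hs hF _
  | succ j ih =>
    exact vanishesToOrder_succ_of_fderiv hF (hp (h 0 (Nat.zero_le _))) fun i =>
      ih (hs hF _) fun r hr => iteratedFDeriv_fderiv_apply_eq_zero hF (h _ (by omega)) _

/-! ### The Riemannian distance on a compact manifold -/

section Riemannian

variable {m : ℕ} {M : Type*} [TopologicalSpace M] [ChartedSpace (EuclideanSpace ℝ (Fin m)) M]
    [IsManifold (𝓡 m) ∞ M] [Bundle.RiemannianBundle (fun x : M => TangentSpace (𝓡 m) x)]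

theorem isContinuousRiemannianBundle_of_isContMDiffRiemannianBundle
    [h : IsContMDiffRiemannianBundle (𝓡 m) ∞ (EuclideanSpace ℝ (Fin m))
      (fun x : M => TangentSpace (𝓡 m) x)] :
    IsContinuousRiemannianBundle (EuclideanSpace ℝ (Fin m))
      (fun x : M => TangentSpace (𝓡 m) x) := by
  obtain ⟨g, hg, h⟩ := h.exists_contMDiff
  exact ⟨g, hg.continuous, h⟩

variable [IsContMDiffRiemannianBundle (𝓡 m) ∞ (EuclideanSpace ℝ (Fin m))
      (fun x : M => TangentSpace (𝓡 m) x)]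

theorem riemannianEDist_ne_top [ConnectedSpace M] (x y : M) : riemannianEDist (𝓡 m) x y ≠ ⊤ := by
  have := isContinuousRiemannianBundle_of_isContMDiffRiemannianBundle (m := m) (M := M)
  have hnear := fun z : M => eventually_riemannianEDist_lt (𝓡 m) z ENNReal.zero_lt_top
  -- Points at finite distance from `x` form a clopen set, as nearby points are at finite distance.
  have hclopen : IsClopen {z : M | riemannianEDist (𝓡 m) x z < ⊤} := by
    refine ⟨⟨isOpen_iff_mem_nhds.2 fun z hz => ?_⟩, isOpen_iff_mem_nhds.2 fun z hz => ?_⟩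
    · filter_upwards [hnear z] with z' hz' hxz'
      refine hz (riemannianEDist_triangle.trans_lt (ENNReal.add_lt_top.2 ⟨hxz', ?_⟩))
      rwa [riemannianEDist_comm]
    · filter_upwards [hnear z] with z' hz'
      exact riemannianEDist_triangle.trans_lt (ENNReal.add_lt_top.2 ⟨hz, hz'⟩)
  have huniv := hclopen.eq_univ ⟨x, by simp [riemannianEDist_self]⟩
  exact (huniv ▸ Set.mem_univ y : y ∈ {z : M | riemannianEDist (𝓡 m) x z < ⊤}).ne

theorem eq_of_riemannianEDist_eq_zero [T3Space M] {x y : M} (h : riemannianEDist (𝓡 m) x y = 0) :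
    x = y := by
  have := isContinuousRiemannianBundle_of_isContMDiffRiemannianBundle (m := m) (M := M)
  let := EMetricSpace.ofRiemannianMetric (𝓡 m) M
  exact edist_eq_zero.1 h

/-- A compact Riemannian manifold is complete. -/
theorem exists_tendsto_of_cauchy_riemannianEDist [T3Space M] [CompactSpace M] {x : ℕ → M}
    (hx : ∀ ε > 0, ∃ n₀, ∀ n ≥ n₀, ∀ p ≥ n₀, riemannianEDist (𝓡 m) (x n) (x p) < ε) :
    ∃ y, Filter.Tendsto x Filter.atTop (nhds y) ∧
      ∀ ε > 0, ∀ᶠ n in Filter.atTop, riemannianEDist (𝓡 m) (x n) y < ε := by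
  have := isContinuousRiemannianBundle_of_isContMDiffRiemannianBundle (m := m) (M := M)
  let := EMetricSpace.ofRiemannianMetric (𝓡 m) M
  have hc : CauchySeq x := EMetric.cauchySeq_iff.2 fun ε hε => by
    obtain ⟨n₀, h⟩ := hx ε hε
    exact ⟨n₀, fun n hn p hp => h n hn p hp⟩
  obtain ⟨y, hy⟩ := cauchySeq_tendsto_of_complete hc
  exact ⟨y, hy, fun ε hε => EMetric.tendsto_nhds.1 hy ε hε⟩

end Riemannian

/-! ### Infinitely near points and germs -/

/-- Germs of smooth functions at a point are germs of global smooth functions. -/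
theorem exists_contMDiffMap_eventuallyEq {E : Type*} [NormedAddCommGroup E] [NormedSpace ℝ E]
    [FiniteDimensional ℝ E] {H : Type*} [TopologicalSpace H] (I : ModelWithCorners ℝ E H)
    {M : Type*} [TopologicalSpace M] [ChartedSpace H M] [IsManifold I ∞ M] [T2Space M]
    [NormalSpace M] [SigmaCompactSpace M] {U : Set M} (hU : IsOpen U) {x : M} (hx : x ∈ U)
    {u : M → ℝ} (hu : ContMDiffOn I 𝓘(ℝ, ℝ) ∞ u U) :
    ∃ f : C^∞⟮I, M; 𝓘(ℝ, ℝ), ℝ⟯, f =ᶠ[𝓝 x] u := by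
  obtain ⟨K, hK, hKc, hKU⟩ := exists_mem_nhds_isClosed_subset (hU.mem_nhds hx)
  obtain ⟨ψ, hψ1, hψ0, -⟩ := exists_contMDiffMap_one_nhds_of_subset_interior (n := ⊤) I
    (isClosed_singleton (x := x)) (t := K) (by simpa using mem_interior_iff_mem_nhds.2 hK)
  have hsupp : tsupport ψ ⊆ K :=
    closure_minimal (fun y hy => by_contra fun h => hy (hψ0 y h)) hKc
  refine ⟨⟨fun y => ψ y * u y, contMDiff_of_tsupport fun y hy => ?_⟩, ?_⟩
  · have hyU : y ∈ U := hKU (hsupp (closure_mono (Function.support_mul_subset_left _ _) hy))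
    exact (ψ.contMDiff y).mul (hu.contMDiffAt (hU.mem_nhds hyU))
  · rw [nhdsSet_singleton] at hψ1
    filter_upwards [hψ1] with y hy
    simp [hy]

theorem contDiffOn_comp_chart_symm {m : ℕ} {M : Type*} [TopologicalSpace M]
    [ChartedSpace (EuclideanSpace ℝ (Fin m)) M]
    {φ : OpenPartialHomeomorph M (EuclideanSpace ℝ (Fin m))}
    (hφ : φ ∈ IsManifold.maximalAtlas (𝓡 m) ∞ M) (f : C^∞⟮𝓡 m, M; 𝓘(ℝ, ℝ), ℝ⟯) :
    ContDiffOn ℝ ∞ (f ∘ φ.symm) φ.target :=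
  contMDiffOn_iff_contDiffOn.1
    (f.contMDiff.comp_contMDiffOn (contMDiffOn_symm_of_mem_maximalAtlas hφ))

namespace WeilBundle

variable {m : ℕ} {M : Type*} [TopologicalSpace M] [ChartedSpace (EuclideanSpace ℝ (Fin m)) M]
  {A : Type*} [CommRing A] [Algebra ℝ A] {𝔫 : Ideal A}

theorem mem_of_apply_base_eq_zero (ζ : WeilBundle m M A 𝔫) {f : C^∞⟮𝓡 m, M; 𝓘(ℝ, ℝ), ℝ⟯}
    (hf : f ζ.base = 0) : ζ.toAlgHom f ∈ 𝔫 := by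
  simpa [hf] using ζ.sub_mem f

variable [IsManifold (𝓡 m) ∞ M] [T2Space M] [CompactSpace M]

/-- An infinitely near point only sees germs. A bump function supported where `f` and `g` agree is
sent to `1` plus a nilpotent element, hence to a unit, and it kills `f - g`. -/
theorem toAlgHom_congr {k : ℕ} (hk : 𝔫 ^ (k + 1) = ⊥) (ζ : WeilBundle m M A 𝔫)
    {f g : C^∞⟮𝓡 m, M; 𝓘(ℝ, ℝ), ℝ⟯} (h : f =ᶠ[𝓝 ζ.base] g) : ζ.toAlgHom f = ζ.toAlgHom g := by
  obtain ⟨ρ, hρ1, hρ0, -⟩ := exists_contMDiffMap_one_nhds_of_subset_interior (n := ⊤) (𝓡 m)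
    (isClosed_singleton (x := ζ.base)) (t := {y | f y = g y})
    (by simpa using mem_interior_iff_mem_nhds.2 h)
  have hzero : (f - g) * ρ = 0 := by
    ext y
    by_cases hy : f y = g y
    · simp [hy]
    · simp [hρ0 y hy]
  have hbase : ρ ζ.base = 1 := hρ1.self_of_nhdsSet _ rfl
  have hunit : IsUnit (ζ.toAlgHom ρ) := by
    have hn : IsNilpotent (ζ.toAlgHom ρ - 1) := by
      -- `ρ` has value `1` at the base point, so that this is the infinitesimal part of `ρ`.
      refine ⟨k + 1, ?_⟩
      have := Ideal.pow_mem_pow (ζ.sub_mem ρ) (k + 1)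
      simpa [hk, hbase] using this
    simpa using hn.isUnit_one_add
  have := congrArg ζ.toAlgHom hzero
  rw [map_mul, map_sub, map_zero, hunit.mul_left_eq_zero, sub_eq_zero] at this
  exact this

/-- In a chart around its base point, an infinitely near point sends functions vanishing to order
`j` into the `j`-th power of the maximal ideal. -/
theorem mem_pow_of_vanishesToOrder {k : ℕ} (hk : 𝔫 ^ (k + 1) = ⊥) (ζ : WeilBundle m M A 𝔫)
    {φ : OpenPartialHomeomorph M (EuclideanSpace ℝ (Fin m))}
    (hφ : φ ∈ IsManifold.maximalAtlas (𝓡 m) ∞ M) (hζ : ζ.base ∈ φ.source) {j : ℕ}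
    {F : EuclideanSpace ℝ (Fin m) → ℝ} (hF : VanishesToOrder (φ ζ.base) j F)
    {f : C^∞⟮𝓡 m, M; 𝓘(ℝ, ℝ), ℝ⟯} (hf : f =ᶠ[𝓝 ζ.base] F ∘ φ) : ζ.toAlgHom f ∈ 𝔫 ^ j := by
  have hgerm : ∀ {G : EuclideanSpace ℝ (Fin m) → ℝ}, ContDiff ℝ ∞ G →
      ∃ g : C^∞⟮𝓡 m, M; 𝓘(ℝ, ℝ), ℝ⟯, g =ᶠ[𝓝 ζ.base] G ∘ φ := fun hG =>
    exists_contMDiffMap_eventuallyEq (𝓡 m) φ.open_source hζ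
      (hG.contMDiff.comp_contMDiffOn (contMDiffOn_of_mem_maximalAtlas hφ))
  induction j generalizing F f with
  | zero => simp
  | succ j ih =>
    obtain ⟨g, hg, rfl⟩ := hF
    choose H hH using fun i : Fin m => hgerm
      (G := fun y => y i - φ ζ.base i) (by fun_prop)
    choose G hG using fun i : Fin m => hgerm (hg i).contDiff
    have hsum : ζ.toAlgHom f = ζ.toAlgHom (∑ i, H i * G i) := by
      refine ζ.toAlgHom_congr hk ?_
      filter_upwards [hf, eventually_all.2 hH, eventually_all.2 hG] with y hy hHy hGy
      rw [hy]
      have : (∑ i, H i * G i : C^∞⟮𝓡 m, M; 𝓘(ℝ, ℝ), ℝ⟯) y = ∑ i, H i y * G i y :=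
        map_sum ((Pi.evalRingHom (fun _ : M => ℝ) y).comp ContMDiffMap.coeFnRingHom) _ _
      rw [this]
      simp [hHy, hGy]
    rw [hsum, map_sum, pow_succ']
    refine Ideal.sum_mem _ fun i _ => ?_
    rw [map_mul]
    refine Ideal.mul_mem_mul (ζ.mem_of_apply_base_eq_zero ?_) (ih (hg i) (hG i))
    rw [(hH i).eq_of_nhds]
    simp

/-- An infinitely near point kills every function whose `k`-jet at the base point vanishes. -/
theorem toAlgHom_eq_zero_of_jet_eq_zero {k : ℕ} (hk : 𝔫 ^ (k + 1) = ⊥) (ζ : WeilBundle m M A 𝔫)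
    {φ : OpenPartialHomeomorph M (EuclideanSpace ℝ (Fin m))}
    (hφ : φ ∈ IsManifold.maximalAtlas (𝓡 m) ∞ M) (hζ : ζ.base ∈ φ.source)
    {f : C^∞⟮𝓡 m, M; 𝓘(ℝ, ℝ), ℝ⟯}
    (hf : ∀ r ≤ k, ∀ i : Fin r → Fin m, chartPartialDeriv φ i f ζ.base = 0) :
    ζ.toAlgHom f = 0 := by
  -- The chart expression of `f` is smooth on the chart target only: `F` extends its germ to `ℝᵐ`.
  obtain ⟨F, hF⟩ := exists_contMDiffMap_eventuallyEq 𝓘(ℝ, EuclideanSpace ℝ (Fin m))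
    φ.open_target (φ.map_source hζ)
    (contMDiffOn_iff_contDiffOn.2 (contDiffOn_comp_chart_symm hφ f))
  have hjet : ∀ r ≤ k, iteratedFDeriv ℝ r F (φ ζ.base) = 0 := by
    intro r hr
    rw [(hF.iteratedFDeriv ℝ r).eq_of_nhds]
    refine ContinuousMultilinearMap.toMultilinearMap_injective ?_
    refine Module.Basis.ext_multilinear
      (fun _ => (EuclideanSpace.basisFun (Fin m) ℝ).toBasis) fun i => ?_
    simpa [chartPartialDeriv] using hf r hr i
  have hmem := ζ.mem_pow_of_vanishesToOrder hk hφ hζ (f := f)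
    (vanishesToOrder_of_iteratedFDeriv_eq_zero F.contMDiff.contDiff hjet) ?_
  · rwa [hk, Ideal.mem_bot] at hmem
  · filter_upwards [(φ.continuousAt hζ).eventually hF, φ.open_source.mem_nhds hζ] with y hy hys
    simp only [Function.comp_apply] at hy ⊢
    rw [hy, φ.left_inv hys]

end WeilBundle

/-! ### Infinitely near points and jets -/

theorem LinearMap.exists_eq_comp_of_ker_le_ker {K V W Z : Type*} [Field K] [AddCommGroup V]
    [Module K V] [AddCommGroup W] [Module K W] [AddCommGroup Z] [Module K Z] (J : V →ₗ[K] W)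
    (L : V →ₗ[K] Z) (h : LinearMap.ker J ≤ LinearMap.ker L) : ∃ T : W →ₗ[K] Z, L = T ∘ₗ J := by
  obtain ⟨T, hT⟩ := ((LinearMap.ker J).liftQ L h ∘ₗ
    J.quotKerEquivRange.symm.toLinearMap).exists_extend
  refine ⟨T, LinearMap.ext fun v => ?_⟩
  have h1 := LinearMap.congr_fun hT ⟨J v, v, rfl⟩
  have h2 : J.quotKerEquivRange.symm ⟨J v, v, rfl⟩ = (LinearMap.ker J).mkQ v :=
    J.quotKerEquivRange_symm_apply_image v _
  simpa [h2] using h1.symm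

theorem Seminorm.exists_bound_of_linearMap_pi {ι Z : Type*} [Fintype ι] [AddCommGroup Z]
    [Module ℝ Z] (S : Seminorm ℝ Z) (T : (ι → ℝ) →ₗ[ℝ] Z) :
    ∃ C : ℝ, ∀ v : ι → ℝ, (∀ i, |v i| ≤ 1) → S (T v) ≤ C := by
  classical
  refine ⟨∑ i, S (T (Pi.single i 1)), fun v hv => ?_⟩
  rw [LinearMap.pi_apply_eq_sum_univ T v]
  refine (Finset.le_sum_of_subadditive S (map_zero S).le (map_add_le_add S) _ _).trans
    (Finset.sum_le_sum fun i _ => ?_)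
  rw [map_smul_eq_mul, Real.norm_eq_abs]
  have : (fun j => if i = j then (1 : ℝ) else 0) = Pi.single i 1 := by
    ext j; simp [Pi.single_apply, eq_comm]
  rw [this]
  exact mul_le_of_le_one_left (apply_nonneg S _) (hv i)

section Jets

variable {m : ℕ} {M : Type*} [TopologicalSpace M] [ChartedSpace (EuclideanSpace ℝ (Fin m)) M]

theorem contDiffAt_comp_chart_symm {φ : OpenPartialHomeomorph M (EuclideanSpace ℝ (Fin m))}
    (hφ : φ ∈ IsManifold.maximalAtlas (𝓡 m) ∞ M) (f : C^∞⟮𝓡 m, M; 𝓘(ℝ, ℝ), ℝ⟯) {x : M}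
    (hx : x ∈ φ.source) (r : ℕ) : ContDiffAt ℝ r (f ∘ φ.symm) (φ x) :=
  ((contDiffOn_comp_chart_symm hφ f).contDiffAt
    (φ.open_target.mem_nhds (φ.map_source hx))).of_le (by exact_mod_cast le_top)

theorem continuousOn_chartPartialDeriv {φ : OpenPartialHomeomorph M (EuclideanSpace ℝ (Fin m))}
    (hφ : φ ∈ IsManifold.maximalAtlas (𝓡 m) ∞ M) (f : C^∞⟮𝓡 m, M; 𝓘(ℝ, ℝ), ℝ⟯) {r : ℕ}
    (i : Fin r → Fin m) : ContinuousOn (chartPartialDeriv φ i f) φ.source := by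
  have h1 : ContinuousOn (iteratedFDeriv ℝ r (f ∘ φ.symm)) φ.target :=
    ((contDiffOn_comp_chart_symm hφ f).continuousOn_iteratedFDerivWithin
      (by exact_mod_cast le_top) φ.open_target.uniqueDiffOn).congr
        fun y hy => (iteratedFDerivWithin_of_isOpen r φ.open_target hy).symm
  have h2 := h1.comp φ.continuousOn φ.mapsTo
  exact (ContinuousEvalConst.continuous_eval_const (F := ContinuousMultilinearMap ℝ
    (fun _ : Fin r => EuclideanSpace ℝ (Fin m)) ℝ)
      (fun s => EuclideanSpace.single (i s) (1 : ℝ))).comp_continuousOn h2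

/-- The partial derivatives of order at most `k` at a point, as a linear map. -/
noncomputable def jetMap {φ : OpenPartialHomeomorph M (EuclideanSpace ℝ (Fin m))}
    (hφ : φ ∈ IsManifold.maximalAtlas (𝓡 m) ∞ M) (k : ℕ) {x : M} (hx : x ∈ φ.source) :
    C^∞⟮𝓡 m, M; 𝓘(ℝ, ℝ), ℝ⟯ →ₗ[ℝ] ((Σ r : Fin (k + 1), Fin r → Fin m) → ℝ) where
  toFun f s := chartPartialDeriv φ s.2 f x
  map_add' f g := funext fun s => by
    have := iteratedFDeriv_add_apply (contDiffAt_comp_chart_symm hφ f hx s.1)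
      (contDiffAt_comp_chart_symm hφ g hx s.1)
    exact congrArg (fun L => L fun a => EuclideanSpace.single (s.2 a) (1 : ℝ)) this
  map_smul' c f := funext fun s => by
    have := iteratedFDeriv_const_smul_apply (a := c) (contDiffAt_comp_chart_symm hφ f hx s.1)
    exact congrArg (fun L => L fun a => EuclideanSpace.single (s.2 a) (1 : ℝ)) this

theorem chartPartialDeriv_smul {φ : OpenPartialHomeomorph M (EuclideanSpace ℝ (Fin m))}
    (hφ : φ ∈ IsManifold.maximalAtlas (𝓡 m) ∞ M) {x : M} (hx : x ∈ φ.source) {r : ℕ}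
    (i : Fin r → Fin m) (c : ℝ) (f : C^∞⟮𝓡 m, M; 𝓘(ℝ, ℝ), ℝ⟯) :
    chartPartialDeriv φ i (c • f : C^∞⟮𝓡 m, M; 𝓘(ℝ, ℝ), ℝ⟯) x = c * chartPartialDeriv φ i f x :=
  congrFun (map_smul (jetMap hφ r hx) c f) ⟨Fin.last r, i⟩

/-- By compactness of the pieces, the `C^k` unit ball is absorbing. -/
theorem exists_smul_mem_ckUnitBall (𝒰 : CompactAtlas m M) (k : ℕ)
    (f : C^∞⟮𝓡 m, M; 𝓘(ℝ, ℝ), ℝ⟯) : ∃ c : ℝ, 0 < c ∧ c • f ∈ ckUnitBall 𝒰 k := by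
  have hb : ∀ s : Σ _ : Fin 𝒰.card, Σ r : Fin (k + 1), Fin r → Fin m,
      ∃ C : ℝ, ∀ x ∈ 𝒰.piece s.1, ‖chartPartialDeriv (𝒰.chart s.1) s.2.2 f x‖ ≤ C := fun s =>
    (𝒰.isCompact_piece s.1).exists_bound_of_continuousOn
      ((continuousOn_chartPartialDeriv (𝒰.chart_mem s.1) f s.2.2).mono (𝒰.piece_subset s.1))
  choose C hC using hb
  have hpos : 0 < 1 + ∑ s, |C s| := by positivity
  refine ⟨(1 + ∑ s, |C s|)⁻¹, inv_pos.2 hpos, fun j x hx r hr i => ?_⟩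
  rw [chartPartialDeriv_smul (𝒰.chart_mem j) (𝒰.piece_subset j hx), abs_mul,
    abs_of_pos (inv_pos.2 hpos), inv_mul_le_one₀ hpos]
  have h1 := hC ⟨j, ⟨r, by omega⟩, i⟩ x hx
  have h2 := Finset.single_le_sum (f := fun s => |C s|) (fun s _ => abs_nonneg _)
    (Finset.mem_univ ⟨j, ⟨r, by omega⟩, i⟩)
  have h3 := le_abs_self (C ⟨j, ⟨r, by omega⟩, i⟩)
  rw [Real.norm_eq_abs] at h1
  simp only at h1 h2 h3 ⊢
  linarith

namespace WeilBundle

variable {A : Type*} [CommRing A] [Algebra ℝ A] {𝔫 : Ideal A}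

/-- The infinitesimal part as a linear map. -/
noncomputable def infinitesimalPartLinear (ζ : WeilBundle m M A 𝔫) :
    C^∞⟮𝓡 m, M; 𝓘(ℝ, ℝ), ℝ⟯ →ₗ[ℝ] A where
  toFun := ζ.infinitesimalPart
  map_add' f g := by
    simp only [infinitesimalPart, map_add, ContMDiffMap.coe_add, Pi.add_apply]
    ring
  map_smul' c f := by
    simp only [infinitesimalPart, map_smul, ContMDiffMap.coe_smul, Pi.smul_apply, smul_eq_mul,
      map_mul, RingHom.id_apply, smul_sub]
    rw [Algebra.smul_def c (algebraMap ℝ A (f ζ.base))]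

/-- The infinitesimal part at `ζ` is a linear function of the `k`-jet at the base point, which has
finitely many coordinates, all bounded on the `C^k` unit ball. -/
theorem exists_bound_infinitesimalPart [IsManifold (𝓡 m) ∞ M] [T2Space M] [CompactSpace M]
    {k : ℕ} (hk : 𝔫 ^ (k + 1) = ⊥) (S : Seminorm ℝ A) (𝒰 : CompactAtlas m M)
    (ζ : WeilBundle m M A 𝔫) :
    ∃ C : ℝ, ∀ f ∈ ckUnitBall 𝒰 k, S (ζ.infinitesimalPart f) ≤ C := by
  obtain ⟨j, hj⟩ : ∃ j, ζ.base ∈ 𝒰.piece j :=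
    Set.mem_iUnion.1 (𝒰.iUnion_piece ▸ Set.mem_univ ζ.base)
  have hζ := 𝒰.piece_subset j hj
  obtain ⟨T, hT⟩ := LinearMap.exists_eq_comp_of_ker_le_ker
    (jetMap (𝒰.chart_mem j) k hζ) ζ.infinitesimalPartLinear fun f hf => by
      have hjet : ∀ r ≤ k, ∀ i : Fin r → Fin m,
          chartPartialDeriv (𝒰.chart j) i f ζ.base = 0 := fun r hr i =>
        congrFun (LinearMap.mem_ker.1 hf) ⟨⟨r, by omega⟩, i⟩
      have hbase : f ζ.base = 0 := by
        simpa [chartPartialDeriv, (𝒰.chart j).left_inv hζ] using hjet 0 (Nat.zero_le k) Fin.elim0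
      have := ζ.toAlgHom_eq_zero_of_jet_eq_zero hk (𝒰.chart_mem j) hζ hjet
      simp [infinitesimalPartLinear, infinitesimalPart, this, hbase]
  obtain ⟨C, hC⟩ := S.exists_bound_of_linearMap_pi T
  refine ⟨C, fun f hf => ?_⟩
  have h := LinearMap.congr_fun hT f
  change ζ.infinitesimalPart f = _ at h
  rw [h]
  exact hC _ fun s => hf j _ hj _ (Nat.lt_succ_iff.1 s.1.2) s.2

end WeilBundle

end Jets

/-! ### Limits in finite-dimensional algebras and the weighted norm -/

section FiniteDimensionalLimits

variable {A : Type*} [CommRing A] [Algebra ℝ A] [FiniteDimensional ℝ A]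

/-- The normed group structure of a definite seminorm. -/
abbrev Seminorm.normedAddCommGroup {V : Type*} [AddCommGroup V] [Module ℝ V] (S : Seminorm ℝ V)
    (hS : ∀ a, S a = 0 → a = 0) : NormedAddCommGroup V :=
  AddGroupNorm.toNormedAddCommGroup { S.toAddGroupSeminorm with eq_zero_of_map_eq_zero' := hS }

/-- The normed space structure over `Seminorm.normedAddCommGroup`. -/
abbrev Seminorm.normedSpace {V : Type*} [AddCommGroup V] [Module ℝ V] (S : Seminorm ℝ V)
    (hS : ∀ a, S a = 0 → a = 0) :
    letI := S.normedAddCommGroup hS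
    NormedSpace ℝ V :=
  letI := S.normedAddCommGroup hS
  { norm_smul_le := fun c a => (map_smul_eq_mul S c a).le }

theorem Submodule.mem_of_tendsto_seminorm {V : Type*} [AddCommGroup V] [Module ℝ V]
    [FiniteDimensional ℝ V] (S : Seminorm ℝ V) (hS : ∀ a, S a = 0 → a = 0)
    (P : Submodule ℝ V) {a : ℕ → V} {b : V} (ha : ∀ n, a n ∈ P)
    (h : Tendsto (fun n => S (a n - b)) atTop (𝓝 0)) : b ∈ P := by
  let := S.normedAddCommGroup hS
  let := S.normedSpace hS
  exact P.closed_of_finiteDimensional.mem_of_tendsto (tendsto_iff_norm_sub_tendsto_zero.2 h)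
    (.of_forall ha)

/-- In a finite-dimensional algebra, multiplication is continuous for every norm of the underlying
vector space, so that a pointwise limit of algebra morphisms is an algebra morphism. -/
theorem exists_algHom_tendsto_of_cauchy {R : Type*} [CommRing R] [Algebra ℝ R]
    (S : Seminorm ℝ A) (hS : ∀ a, S a = 0 → a = 0) (u : ℕ → R →ₐ[ℝ] A)
    (hu : ∀ f, ∀ ε > 0, ∃ n₀, ∀ n ≥ n₀, S (u n f - u n₀ f) < ε) :
    ∃ v : R →ₐ[ℝ] A, ∀ f, Tendsto (fun n => S (u n f - v f)) atTop (𝓝 0) := by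
  let := S.normedAddCommGroup hS
  let := S.normedSpace hS
  have : CompleteSpace A := FiniteDimensional.complete ℝ A
  have hlim : ∀ f, ∃ a, Tendsto (fun n => u n f) atTop (𝓝 a) := fun f =>
    cauchySeq_tendsto_of_complete (Metric.cauchySeq_iff'.2 fun ε hε => by
      obtain ⟨n₀, h⟩ := hu f ε hε
      exact ⟨n₀, fun n hn => (dist_eq_norm _ _).trans_lt (h n hn)⟩)
  choose v hv using hlim
  have hmul : ∀ {a b : ℕ → A} {a' b' : A}, Tendsto a atTop (𝓝 a') → Tendsto b atTop (𝓝 b') →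
      Tendsto (fun n => a n * b n) atTop (𝓝 (a' * b')) := by
    intro a b a' b' ha hb
    -- No submultiplicative norm is at hand: multiplication is continuous because the linear map
    -- `A → (A →L[ℝ] A)` is, by finite dimension.
    let μ : A →ₗ[ℝ] A →L[ℝ] A := LinearMap.toContinuousLinearMap.toLinearMap ∘ₗ LinearMap.mul ℝ A
    have h : Tendsto (fun n => μ (a n)) atTop (𝓝 (μ a')) :=
      (μ.continuous_of_finiteDimensional.tendsto a').comp ha
    exact ((isBoundedBilinearMap_apply (𝕜 := ℝ) (E := A) (F := A)).continuous.tendsto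
      (μ a', b')).comp (h.prodMk_nhds hb)
  let L : R →ₗ[ℝ] A :=
    { toFun := v
      map_add' := fun f g => tendsto_nhds_unique (hv (f + g))
        (by simpa using (hv f).add (hv g))
      map_smul' := fun c f => tendsto_nhds_unique (hv (c • f))
        (by simpa using (hv f).const_smul c) }
  refine ⟨AlgHom.ofLinearMap L (tendsto_nhds_unique (hv 1) (by simp)) fun f g =>
    tendsto_nhds_unique (hv (f * g)) (by
      simp only [map_mul]
      exact hmul (hv f) (hv g)), fun f =>
      tendsto_iff_norm_sub_tendsto_zero.1 (hv f)⟩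

end FiniteDimensionalLimits

section WeightedNorm

variable {A : Type*} [CommRing A] [Algebra ℝ A] {n : ℕ}

/-- `weightedNorm` as a seminorm. -/
noncomputable def weightedSeminorm (N : Seminorm ℝ A) (α : Module.Basis (Fin (n + 1)) ℝ A)
    (w : Fin (n + 1) → ℝ) : Seminorm ℝ A :=
  Seminorm.of (weightedNorm N α w)
    (fun a b => by
      have : ∑ i : Fin n, (α.repr (a + b) i.succ * w i.succ) • α i.succ =
          ∑ i : Fin n, (α.repr a i.succ * w i.succ) • α i.succ +
            ∑ i : Fin n, (α.repr b i.succ * w i.succ) • α i.succ := by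
        simp [add_mul, add_smul, Finset.sum_add_distrib]
      rw [weightedNorm, this, map_add, Finsupp.add_apply]
      have h1 := abs_add_le (α.repr a 0) (α.repr b 0)
      have h2 := map_add_le_add N (∑ i : Fin n, (α.repr a i.succ * w i.succ) • α i.succ)
        (∑ i : Fin n, (α.repr b i.succ * w i.succ) • α i.succ)
      simp only [weightedNorm]
      linarith)
    (fun c a => by
      have : ∑ i : Fin n, (α.repr (c • a) i.succ * w i.succ) • α i.succ =
          c • ∑ i : Fin n, (α.repr a i.succ * w i.succ) • α i.succ := by
        simp [Finset.smul_sum, smul_smul, mul_assoc]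
      rw [weightedNorm, this, map_smul_eq_mul]
      simp [weightedNorm, abs_mul, mul_add])

theorem eq_zero_of_weightedSeminorm_eq_zero (N : Seminorm ℝ A) (hN : ∀ a, N a = 0 → a = 0)
    (α : Module.Basis (Fin (n + 1)) ℝ A) {w : Fin (n + 1) → ℝ} (hw : ∀ i, 0 < w i) (a : A)
    (ha : weightedSeminorm N α w a = 0) : a = 0 := by
  change |α.repr a 0| + N (∑ i : Fin n, (α.repr a i.succ * w i.succ) • α i.succ) = 0 at ha
  obtain ⟨h0, h1⟩ := (add_eq_zero_iff_of_nonneg (abs_nonneg _) (apply_nonneg N _)).1 ha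
  have hli := Fintype.linearIndependent_iff.1
    (α.linearIndependent.comp Fin.succ (Fin.succ_injective n)) _ (hN _ h1)
  refine α.repr.map_eq_zero_iff.1 (Finsupp.ext fun i => ?_)
  refine Fin.cases (abs_eq_zero.1 h0) (fun i => ?_) i
  exact (mul_eq_zero.1 (hli i)).resolve_right (hw _).ne'

end WeightedNorm

/-! ### The distance between infinitely near points -/

section Distance

variable {m : ℕ} {M : Type*} [TopologicalSpace M] [ChartedSpace (EuclideanSpace ℝ (Fin m)) M]
    {A : Type*} [CommRing A] [Algebra ℝ A] {𝔫 : Ideal A}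

/-- The fibre part of the distance, for an arbitrary seminorm on the algebra. -/
noncomputable def fiberEDist (𝒰 : CompactAtlas m M) (k : ℕ) (S : Seminorm ℝ A)
    (ϑ ε : WeilBundle m M A 𝔫) : ℝ≥0∞ :=
  ⨆ f ∈ ckUnitBall 𝒰 k, ENNReal.ofReal (S (ϑ.infinitesimalPart f - ε.infinitesimalPart f))

variable {𝒰 : CompactAtlas m M} {k : ℕ} {S : Seminorm ℝ A} {ϑ ε η : WeilBundle m M A 𝔫}

theorem fiberEDist_le_iff {c : ℝ≥0∞} : fiberEDist 𝒰 k S ϑ ε ≤ c ↔ ∀ f ∈ ckUnitBall 𝒰 k,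
    ENNReal.ofReal (S (ϑ.infinitesimalPart f - ε.infinitesimalPart f)) ≤ c := iSup₂_le_iff

theorem ofReal_le_fiberEDist {f : C^∞⟮𝓡 m, M; 𝓘(ℝ, ℝ), ℝ⟯} (hf : f ∈ ckUnitBall 𝒰 k) :
    ENNReal.ofReal (S (ϑ.infinitesimalPart f - ε.infinitesimalPart f)) ≤ fiberEDist 𝒰 k S ϑ ε :=
  fiberEDist_le_iff.1 le_rfl f hf

theorem fiberEDist_self : fiberEDist 𝒰 k S ϑ ϑ = 0 := by simp [fiberEDist]

theorem fiberEDist_comm : fiberEDist 𝒰 k S ϑ ε = fiberEDist 𝒰 k S ε ϑ := by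
  simp only [fiberEDist, map_sub_rev S]

theorem fiberEDist_triangle :
    fiberEDist 𝒰 k S ϑ η ≤ fiberEDist 𝒰 k S ϑ ε + fiberEDist 𝒰 k S ε η := by
  refine fiberEDist_le_iff.2 fun f hf => ?_
  refine le_trans ?_ (add_le_add (ofReal_le_fiberEDist hf) (ofReal_le_fiberEDist hf))
  rw [← ENNReal.ofReal_add (apply_nonneg _ _) (apply_nonneg _ _)]
  refine ENNReal.ofReal_le_ofReal ?_
  rw [← sub_add_sub_cancel (ϑ.infinitesimalPart f) (ε.infinitesimalPart f)]
  exact map_add_le_add S _ _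

theorem fiberEDist_ne_top [IsManifold (𝓡 m) ∞ M] [T2Space M] [CompactSpace M]
    (hk : 𝔫 ^ (k + 1) = ⊥) : fiberEDist 𝒰 k S ϑ ε ≠ ⊤ := by
  obtain ⟨C, hC⟩ := ϑ.exists_bound_infinitesimalPart hk S 𝒰
  obtain ⟨D, hD⟩ := ε.exists_bound_infinitesimalPart hk S 𝒰
  refine ne_top_of_le_ne_top (ENNReal.ofReal_ne_top (r := C + D)) (fiberEDist_le_iff.2 fun f hf =>
    ENNReal.ofReal_le_ofReal ((map_sub_le_add S _ _).trans (add_le_add (hC f hf) (hD f hf))))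

theorem WeilBundle.infinitesimalPart_smul (ζ : WeilBundle m M A 𝔫) (c : ℝ)
    (f : C^∞⟮𝓡 m, M; 𝓘(ℝ, ℝ), ℝ⟯) :
    ζ.infinitesimalPart (c • f : C^∞⟮𝓡 m, M; 𝓘(ℝ, ℝ), ℝ⟯) = c • ζ.infinitesimalPart f :=
  map_smul ζ.infinitesimalPartLinear c f

/-- As the `C^k` unit ball is absorbing, the fibre distance dominates, up to a factor, the
difference of the infinitesimal parts of any given function. -/
theorem exists_mul_seminorm_le_fiberEDist (𝒰 : CompactAtlas m M) (k : ℕ) (S : Seminorm ℝ A)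
    (f : C^∞⟮𝓡 m, M; 𝓘(ℝ, ℝ), ℝ⟯) : ∃ c : ℝ, 0 < c ∧ ∀ ϑ ε : WeilBundle m M A 𝔫,
      ENNReal.ofReal (c * S (ϑ.infinitesimalPart f - ε.infinitesimalPart f)) ≤
        fiberEDist 𝒰 k S ϑ ε := by
  obtain ⟨c, hc, hf⟩ := exists_smul_mem_ckUnitBall 𝒰 k f
  refine ⟨c, hc, fun ϑ ε => ?_⟩
  have h := ofReal_le_fiberEDist (S := S) (ϑ := ϑ) (ε := ε) hf
  rwa [WeilBundle.infinitesimalPart_smul, WeilBundle.infinitesimalPart_smul, ← smul_sub,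
    map_smul_eq_mul, Real.norm_of_nonneg hc.le] at h

theorem WeilBundle.ext_of_infinitesimalPart (hb : ϑ.base = ε.base)
    (h : ∀ f, ϑ.infinitesimalPart f = ε.infinitesimalPart f) : ϑ = ε := by
  cases ϑ with | mk x u hu => cases ε with | mk y v hv =>
  obtain rfl : x = y := hb
  obtain rfl : u = v := AlgHom.ext fun f => by simpa [infinitesimalPart] using h f
  rfl

theorem eq_of_fiberEDist_eq_zero (hS : ∀ a, S a = 0 → a = 0) (hb : ϑ.base = ε.base)
    (h : fiberEDist 𝒰 k S ϑ ε = 0) : ϑ = ε := by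
  refine WeilBundle.ext_of_infinitesimalPart hb fun f => sub_eq_zero.1 (hS _ ?_)
  obtain ⟨c, hc, hf⟩ := exists_mul_seminorm_le_fiberEDist (𝔫 := 𝔫) 𝒰 k S f
  have h1 := hf ϑ ε
  rw [h, nonpos_iff_eq_zero, ENNReal.ofReal_eq_zero] at h1
  exact le_antisymm (nonpos_of_mul_nonpos_right h1 hc) (apply_nonneg _ _)

/-- The candidate limit is the pointwise limit of the algebra morphisms. The convergence is uniform
on the `C^k` unit ball because the Cauchy bounds pass to the pointwise limit. -/
theorem exists_limit_of_cauchy_fiberEDist [FiniteDimensional ℝ A] (hS : ∀ a, S a = 0 → a = 0)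
    {ζ : ℕ → WeilBundle m M A 𝔫} {x : M} (hx : Tendsto (fun n => (ζ n).base) atTop (𝓝 x))
    (hζ : ∀ δ > 0, ∃ n₀, ∀ n ≥ n₀, ∀ p ≥ n₀, fiberEDist 𝒰 k S (ζ n) (ζ p) < δ) :
    ∃ η : WeilBundle m M A 𝔫, η.base = x ∧
      ∀ δ > 0, ∀ᶠ n in atTop, fiberEDist 𝒰 k S (ζ n) η ≤ δ := by
  have hval : ∀ f : C^∞⟮𝓡 m, M; 𝓘(ℝ, ℝ), ℝ⟯,
      Tendsto (fun n => f (ζ n).base) atTop (𝓝 (f x)) := fun f =>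
    (f.contMDiff.continuous.tendsto x).comp hx
  have hconst : ∀ (a b : ℝ), S (algebraMap ℝ A a - algebraMap ℝ A b) = |a - b| * S 1 := by
    intro a b
    rw [← map_sub, Algebra.algebraMap_eq_smul_one, map_smul_eq_mul, Real.norm_eq_abs]
  have hsplit : ∀ (f : C^∞⟮𝓡 m, M; 𝓘(ℝ, ℝ), ℝ⟯) (ϑ : WeilBundle m M A 𝔫),
      ϑ.toAlgHom f = ϑ.infinitesimalPart f + algebraMap ℝ A (f ϑ.base) := fun f ϑ => by
    simp [WeilBundle.infinitesimalPart]
  obtain ⟨v, hv⟩ := exists_algHom_tendsto_of_cauchy S hS (fun n => (ζ n).toAlgHom) fun f δ hδ => by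
    obtain ⟨c, hc, hf⟩ := exists_mul_seminorm_le_fiberEDist (𝔫 := 𝔫) 𝒰 k S f
    obtain ⟨n₁, h₁⟩ := hζ (ENNReal.ofReal (c * (δ / 2))) (by positivity)
    obtain ⟨n₂, h₂⟩ := Metric.cauchySeq_iff.1 (hval f).cauchySeq (δ / 2 / (S 1 + 1))
      (by positivity)
    refine ⟨max n₁ n₂, fun n hn => ?_⟩
    have h3 := (hf _ _).trans_lt (h₁ n (by omega) (max n₁ n₂) (by omega))
    rw [ENNReal.ofReal_lt_ofReal_iff (by positivity)] at h3
    have h4 := lt_of_mul_lt_mul_left h3 hc.le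
    have h5 := h₂ n (by omega) (max n₁ n₂) (by omega)
    rw [Real.dist_eq, lt_div_iff₀ (by positivity)] at h5
    rw [hsplit, hsplit, add_sub_add_comm]
    refine (map_add_le_add S _ _).trans_lt ?_
    rw [hconst]
    nlinarith [abs_nonneg (f (ζ n).base - f (ζ (max n₁ n₂)).base)]
  have hinf : ∀ f : C^∞⟮𝓡 m, M; 𝓘(ℝ, ℝ), ℝ⟯, Tendsto
      (fun n => S ((ζ n).infinitesimalPart f - (v f - algebraMap ℝ A (f x)))) atTop (𝓝 0) := by
    intro f
    refine squeeze_zero (fun _ => apply_nonneg _ _) (fun n => ?_) (by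
      simpa using (hv f).add (((tendsto_iff_norm_sub_tendsto_zero.1 (hval f))).mul_const (S 1)))
    rw [WeilBundle.infinitesimalPart, sub_sub_sub_comm, ← hconst]
    exact map_sub_le_add S _ _
  refine ⟨⟨x, v, fun f => (𝔫.restrictScalars ℝ).mem_of_tendsto_seminorm S hS
    (fun n => (ζ n).sub_mem f) (hinf f)⟩, rfl, fun δ hδ => ?_⟩
  obtain ⟨n₀, h₀⟩ := hζ δ hδ
  filter_upwards [eventually_ge_atTop n₀] with n hn
  refine fiberEDist_le_iff.2 fun f hf => ?_
  -- The bound `δ` for `ζ n` and `ζ p` holds for each `f` separately as `p` tends to infinity.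
  have hlim : Tendsto (fun p => δ + ENNReal.ofReal
      (S ((ζ p).infinitesimalPart f - (v f - algebraMap ℝ A (f x))))) atTop (𝓝 δ) := by
    simpa using tendsto_const_nhds.add (ENNReal.tendsto_ofReal (hinf f))
  refine ge_of_tendsto hlim ?_
  filter_upwards [eventually_ge_atTop n₀] with p hp
  have h1 := (ofReal_le_fiberEDist (S := S) hf).trans (h₀ n hn p hp).le
  refine le_trans ?_ (add_le_add_left h1 _)
  rw [← ENNReal.ofReal_add (apply_nonneg _ _) (apply_nonneg _ _)]
  refine ENNReal.ofReal_le_ofReal ?_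
  rw [← sub_add_sub_cancel _ ((ζ p).infinitesimalPart f)]
  exact map_add_le_add S _ _

end Distance

section WeilDistance

variable {m : ℕ} {M : Type*} [TopologicalSpace M] [ChartedSpace (EuclideanSpace ℝ (Fin m)) M]
    [Bundle.RiemannianBundle (fun x : M => TangentSpace (𝓡 m) x)]
    {A : Type*} [CommRing A] [Algebra ℝ A] {𝔫 : Ideal A} {n : ℕ}
    (𝒰 : CompactAtlas m M) (k : ℕ) (N : Seminorm ℝ A) (α : Module.Basis (Fin (n + 1)) ℝ A)
    (w : Fin (n + 1) → ℝ) (ϑ ε η : WeilBundle m M A 𝔫)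

theorem weilEDist_eq : weilEDist 𝒰 k N α w ϑ ε =
    riemannianEDist (𝓡 m) ϑ.base ε.base + fiberEDist 𝒰 k (weightedSeminorm N α w) ϑ ε := rfl

theorem weilEDist_self : weilEDist 𝒰 k N α w ϑ ϑ = 0 := by
  rw [weilEDist_eq, riemannianEDist_self, fiberEDist_self, add_zero]

theorem weilEDist_comm : weilEDist 𝒰 k N α w ϑ ε = weilEDist 𝒰 k N α w ε ϑ := by
  rw [weilEDist_eq, weilEDist_eq, riemannianEDist_comm, fiberEDist_comm]

theorem weilEDist_triangle :
    weilEDist 𝒰 k N α w ϑ η ≤ weilEDist 𝒰 k N α w ϑ ε + weilEDist 𝒰 k N α w ε η := by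
  rw [weilEDist_eq, weilEDist_eq, weilEDist_eq, add_add_add_comm]
  exact add_le_add riemannianEDist_triangle fiberEDist_triangle

variable {𝒰 k N α w ϑ ε}
variable [IsManifold (𝓡 m) ∞ M] [T2Space M] [CompactSpace M] [IsContMDiffRiemannianBundle (𝓡 m) ∞
  (EuclideanSpace ℝ (Fin m)) (fun x : M => TangentSpace (𝓡 m) x)]

theorem weilEDist_ne_top [ConnectedSpace M] (hk : 𝔫 ^ (k + 1) = ⊥) :
    weilEDist 𝒰 k N α w ϑ ε ≠ ⊤ := by
  rw [weilEDist_eq]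
  exact ENNReal.add_ne_top.2 ⟨riemannianEDist_ne_top _ _, fiberEDist_ne_top hk⟩

theorem eq_of_weilEDist_eq_zero (hN : ∀ a, N a = 0 → a = 0) (hw : ∀ i, 0 < w i)
    (h : weilEDist 𝒰 k N α w ϑ ε = 0) : ϑ = ε := by
  rw [weilEDist_eq, add_eq_zero] at h
  exact eq_of_fiberEDist_eq_zero (eq_zero_of_weightedSeminorm_eq_zero N hN α hw)
    (eq_of_riemannianEDist_eq_zero h.1) h.2

theorem exists_limit_of_cauchy_weilEDist [FiniteDimensional ℝ A] (hN : ∀ a, N a = 0 → a = 0)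
    (hw : ∀ i, 0 < w i) {ζ : ℕ → WeilBundle m M A 𝔫}
    (hζ : ∀ δ > 0, ∃ n₀, ∀ n ≥ n₀, ∀ p ≥ n₀, weilEDist 𝒰 k N α w (ζ n) (ζ p) < δ) :
    ∃ η : WeilBundle m M A 𝔫,
      ∀ δ > 0, ∀ᶠ n in atTop, weilEDist 𝒰 k N α w (ζ n) η < δ := by
  obtain ⟨x, hx, hbase⟩ := exists_tendsto_of_cauchy_riemannianEDist
    (x := fun n => (ζ n).base) fun δ hδ => by
      obtain ⟨n₀, h⟩ := hζ δ hδ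
      exact ⟨n₀, fun p hp q hq => le_self_add.trans_lt (h p hp q hq)⟩
  obtain ⟨η, rfl, hη⟩ := exists_limit_of_cauchy_fiberEDist (𝒰 := 𝒰) (k := k)
    (eq_zero_of_weightedSeminorm_eq_zero N hN α hw) hx fun δ hδ => by
      obtain ⟨n₀, h⟩ := hζ δ hδ
      exact ⟨n₀, fun p hp q hq => le_add_self.trans_lt (h p hp q hq)⟩
  refine ⟨η, fun δ hδ => ?_⟩
  by_cases htop : δ = ⊤
  · -- The strict addition of bounds needs finite ones, and half of `⊤` is `⊤`.
    subst htop
    filter_upwards [hbase 1 one_pos, hη 1 one_pos] with p h1 h2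
    exact ENNReal.add_lt_top.2
      ⟨h1.trans ENNReal.one_lt_top, h2.trans_lt ENNReal.one_lt_top⟩
  · have hδ2 := ENNReal.half_pos hδ.ne'
    filter_upwards [hbase (δ / 2) hδ2, hη (δ / 2) hδ2] with p h1 h2
    rw [weilEDist_eq, ← ENNReal.add_halves δ]
    exact ENNReal.add_lt_add_of_lt_of_le (ne_top_of_le_ne_top
      (ENNReal.div_ne_top htop two_ne_zero) h2) h1 h2

end WeilDistance

end

theorem theorem3p2 {m : ℕ} {M : Type*} [TopologicalSpace M] [T2Space M] [CompactSpace M]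
    [ConnectedSpace M] [ChartedSpace (EuclideanSpace ℝ (Fin m)) M] [IsManifold (𝓡 m) ∞ M]
    [Bundle.RiemannianBundle (fun x : M => TangentSpace (𝓡 m) x)]
    [IsContMDiffRiemannianBundle (𝓡 m) ∞ (EuclideanSpace ℝ (Fin m))
      (fun x : M => TangentSpace (𝓡 m) x)]
    {A : Type*} [CommRing A] [Algebra ℝ A] (𝔫 : Ideal A) (hA : IsWeilAlgebra A 𝔫)
    (k : ℕ) (hk : 𝔫 ^ (k + 1) = ⊥)
    {n : ℕ} (α : Module.Basis (Fin (n + 1)) ℝ A) (hα_one : α 0 = 1)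
    (hα_mem : ∀ i : Fin n, α i.succ ∈ 𝔫)
    (N : Seminorm ℝ A) (hN : ∀ a, N a = 0 → a = 0)
    (w : Fin (n + 1) → ℝ) (hw : ∀ i, 0 < w i)
    (𝒰 : CompactAtlas m M) :
    ∃ _ : MetricSpace (WeilBundle m M A 𝔫),
      (∀ ϑ ε : WeilBundle m M A 𝔫, edist ϑ ε = weilEDist 𝒰 k N α w ϑ ε) ∧
      CompleteSpace (WeilBundle m M A 𝔫) := by
  have := hA.finiteDimensional
  let E : EMetricSpace (WeilBundle m M A 𝔫) :=
    { edist := weilEDist 𝒰 k N α w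
      edist_self := weilEDist_self 𝒰 k N α w
      edist_comm := weilEDist_comm 𝒰 k N α w
      edist_triangle := weilEDist_triangle 𝒰 k N α w
      eq_of_edist_eq_zero := eq_of_weilEDist_eq_zero hN hw }
  refine ⟨EMetricSpace.toMetricSpace fun _ _ => weilEDist_ne_top hk, fun _ _ => rfl, ?_⟩
  refine EMetric.complete_of_cauchySeq_tendsto fun ζ hζ => ?_
  obtain ⟨η, hη⟩ := exists_limit_of_cauchy_weilEDist hN hw (EMetric.cauchySeq_iff.1 hζ)
  exact ⟨η, EMetric.tendsto_nhds.2 hη⟩
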